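/- Conventions. An exact category is an additive category with a Quillen exact structure, i.e. a class of conflations (kernel-cokernel pairs) $X \xrightarrow{i} Y \xrightarrow{d} Z$, closed under isomorphism and satisfying the usual axioms; $i$ is then called an inflation and $d$ a deflation. A model structure on a category is a triple $(\mathrm{Cof},\mathrm{W},\mathrm{Fib})$ of classes of morphisms such that $\mathrm{W}$ is closed under retracts and has the 2-out-of-3 property, and $(\mathrm{Cof},\mathrm{W}\cap\mathrm{Fib})$ and $(\mathrm{Cof}\cap\mathrm{W},\mathrm{Fib})$ are (not necessarily functorial) weak factorization systems. A model category is a category with a model structure that has an initial object, a terminal object, pushouts of trivial cofibrations along trivial cofibrations and pullbacks of trivial fibrations along trivial fibrations. On an exact category, a weak factorization system $(\mathcal{L},\mathcal{R})$ is exact if: $f\in\mathcal{L}$ if and only if $f$ is an inflation and $0\to\operatorname{Coker} f$ is in $\mathcal{L}$; and $f\in\mathcal{R}$ if and only if $f$ is a deflation and $\operatorname{Ker} f\to 0$ is in $\mathcal{R}$. An exact model category is a weakly idempotent complete exact category (every section has a cokernel) with a model structure for which both weak factorization systems are exact. An object $X$ is cofibrant, trivial, or fibrant if, respectively, $0\to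 X$ is a cofibration, $0\to X$ is a weak equivalence, or $X\to 0$ is a fibration. A monoidal model category is a model category with a closed symmetric monoidal structure $(\otimes,\mathbb{1},\mathcal{H}om)$ such that the unit $\mathbb{1}$ is cofibrant and $\otimes$ is a Quillen bifunctor, that is: for all cofibrations $f\colon U\to V$ and $g\colon X\to Y$ the pushout $P$ of $U\otimes Y\leftarrow U\otimes X\to V\otimes X$ exists, the induced map $f\boxtimes g\colon P\to V\otimes Y$ is a cofibration, and $f \boxtimes g$ is a trivial cofibration if moreover $f$ or $g$ is trivial. An exact monoidal model category is an exact model category with a closed symmetric monoidal structure making it a monoidal model category. Theorem. Let $\mathcal{E}$ be an exact model category, and let $\mathcal{C}$, $\mathcal{W}$, $\mathcal{F}$ be its classes of cofibrant, trivial and fibrant objects. Suppose further that $\mathcal{E}$ carries a closed symmetric monoidal structure $(\otimes,\mathbb{1},\mathcal{H}om)$ such that 1. the tensor unit $\mathbb{1}$ is cofibrant; 2. if $X,Y\in\mathcal{C}$, then $X\otimes Y\in\mathcal{C}$; if, moreover, $X$ or $Y$ is in $\mathcal{C}\cap\mathcal{W}$, then $X\otimes Y\in\mathcal{C}\cap\mathcal{W}$;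 3. if $f\colon X\to Y$ is a cofibration and $U\in\mathcal{E}$ is arbitrary, then $U\otimes f\colon U\otimes X\to U\otimes Y$ is an inflation. Then $\mathcal{E}$ with all this structure is an exact monoidal model category. -/

import Mathlib

open CategoryTheory CategoryTheory.Limits CategoryTheory.MonoidalCategory

universe v u

namespace ExactModel

section ExactStructures

/-- A (Quillen) exact structure on an additive category `E`: a class of kernel-cokernel pairs
`X ⟶ Y ⟶ Z`, called conflations, closed under isomorphisms and subject to the usual axioms.
The first map of a conflation is called an inflation, the second one a deflation. -/
structure ExactStructure (E : Type u) [Category.{v} E] [Preadditive E] [HasZeroObject E]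
    [HasBinaryBiproducts E] where
  /-- the conflations -/
  conflation : ObjectProperty (ShortComplex E)
  conflation_of_iso : ∀ {S T : ShortComplex E}, (S ≅ T) → conflation S → conflation T
  isKernel : ∀ {S : ShortComplex E}, conflation S →
    Nonempty (IsLimit (KernelFork.ofι S.f S.zero))
  isCokernel : ∀ {S : ShortComplex E}, conflation S →
    Nonempty (IsColimit (CokernelCofork.ofπ S.g S.zero))
  id_inflation : ∀ X : E, ∃ (Z : E) (d : X ⟶ Z) (w : 𝟙 X ≫ d = 0),
    conflation (ShortComplex.mk (𝟙 X) d w)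
  id_deflation : ∀ Z : E, ∃ (X : E) (i : X ⟶ Z) (w : i ≫ 𝟙 Z = 0),
    conflation (ShortComplex.mk i (𝟙 Z) w)
  comp_inflation : ∀ {X Y Z : E} (i : X ⟶ Y) (j : Y ⟶ Z),
    (∃ (A : E) (d : Y ⟶ A) (w : i ≫ d = 0), conflation (ShortComplex.mk i d w)) →
    (∃ (A : E) (d : Z ⟶ A) (w : j ≫ d = 0), conflation (ShortComplex.mk j d w)) →
    ∃ (A : E) (d : Z ⟶ A) (w : (i ≫ j) ≫ d = 0), conflation (ShortComplex.mk (i ≫ j) d w)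
  comp_deflation : ∀ {X Y Z : E} (p : X ⟶ Y) (q : Y ⟶ Z),
    (∃ (A : E) (i : A ⟶ X) (w : i ≫ p = 0), conflation (ShortComplex.mk i p w)) →
    (∃ (A : E) (i : A ⟶ Y) (w : i ≫ q = 0), conflation (ShortComplex.mk i q w)) →
    ∃ (A : E) (i : A ⟶ X) (w : i ≫ p ≫ q = 0), conflation (ShortComplex.mk i (p ≫ q) w)
  pushout_inflation : ∀ {X Y X' : E} (i : X ⟶ Y) (a : X ⟶ X'),
    (∃ (A : E) (d : Y ⟶ A) (w : i ≫ d = 0), conflation (ShortComplex.mk i d w)) →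
    ∃ (Y' : E) (a' : Y ⟶ Y') (i' : X' ⟶ Y'), IsPushout i a a' i' ∧
      ∃ (A : E) (d : Y' ⟶ A) (w : i' ≫ d = 0), conflation (ShortComplex.mk i' d w)
  pullback_deflation : ∀ {Y Z Z' : E} (p : Y ⟶ Z) (a : Z' ⟶ Z),
    (∃ (A : E) (i : A ⟶ Y) (w : i ≫ p = 0), conflation (ShortComplex.mk i p w)) →
    ∃ (Y' : E) (a' : Y' ⟶ Y) (p' : Y' ⟶ Z'), IsPullback a' p' p a ∧
      ∃ (A : E) (i : A ⟶ Y') (w : i ≫ p' = 0), conflation (ShortComplex.mk i p' w)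

variable {E : Type u} [Category.{v} E] [Preadditive E] [HasZeroObject E]
    [HasBinaryBiproducts E] (S : ExactStructure E)

/-- The class of inflations. -/
def ExactStructure.inflations : MorphismProperty E := fun _ Y i =>
  ∃ (Z : E) (d : Y ⟶ Z) (w : i ≫ d = 0), S.conflation (ShortComplex.mk i d w)

/-- An exact weak factorization system: a weak factorization system `(L, R)` such that `f` is in
`L` iff `f` is an inflation with `0 ⟶ Coker f` in `L`, and `f` is in `R` iff `f` is a deflation
with `Ker f ⟶ 0` in `R`. -/
structure ExactStructure.IsExactWFS (L R : MorphismProperty E) : Prop where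
  isWFS : L.IsWeakFactorizationSystem R
  left_iff : ∀ {X Y : E} (f : X ⟶ Y), L f ↔
    ∃ (Z : E) (d : Y ⟶ Z) (w : f ≫ d = 0),
      S.conflation (ShortComplex.mk f d w) ∧ L (initial.to Z)
  right_iff : ∀ {X Y : E} (f : X ⟶ Y), R f ↔
    ∃ (A : E) (i : A ⟶ X) (w : i ≫ f = 0),
      S.conflation (ShortComplex.mk i f w) ∧ R (terminal.from A)

end ExactStructures

/-- Every section has a cokernel. -/
def IsWeaklyIdempotentComplete (E : Type u) [Category.{v} E] [Preadditive E] : Prop :=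
  ∀ {X Y : E} (s : X ⟶ Y), IsSplitMono s → HasCokernel s

section ModelStructures

/-- A model structure on a category (factorizations are not required to be functorial and no
limits or colimits are required to exist). -/
structure ModelStructure (C : Type u) [Category.{v} C] where
  /-- cofibrations -/
  cof : MorphismProperty C
  /-- weak equivalences -/
  weq : MorphismProperty C
  /-- fibrations -/
  fib : MorphismProperty C
  weq_retracts : weq.IsStableUnderRetracts
  weq_twoOutOfThree : weq.HasTwoOutOfThreeProperty
  wfs_cof_trivFib : cof.IsWeakFactorizationSystem (weq ⊓ fib)
  wfs_trivCof_fib : (cof ⊓ weq).IsWeakFactorizationSystem fib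

namespace ModelStructure

variable {C : Type u} [Category.{v} C] (M : ModelStructure C)

/-- Trivial cofibrations. -/
def trivCof : MorphismProperty C := M.cof ⊓ M.weq

/-- Trivial fibrations. -/
def trivFib : MorphismProperty C := M.weq ⊓ M.fib

/-- A model category is a category with a model structure, an initial object, a terminal object,
pushouts of trivial cofibrations along trivial cofibrations and pullbacks of trivial fibrations
along trivial fibrations. -/
structure IsModelCategory : Prop where
  hasInitial : HasInitial C
  hasTerminal : HasTerminal C
  hasPushout : ∀ {X Y Z : C} (f : X ⟶ Y) (g : X ⟶ Z), M.trivCof f → M.trivCof g → HasPushout f g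
  hasPullback : ∀ {X Y Z : C} (f : X ⟶ Z) (g : Y ⟶ Z), M.trivFib f → M.trivFib g →
    HasPullback f g

/-- The class of cofibrant objects: those `X` for which `∅ ⟶ X` is a cofibration. -/
def cofibrantObjects [HasInitial C] : ObjectProperty C := fun X => M.cof (initial.to X)

/-- The class of trivial objects: those `X` for which `∅ ⟶ X` is a weak equivalence. -/
def trivialObjects [HasInitial C] : ObjectProperty C := fun X => M.weq (initial.to X)

/-- The class of fibrant objects: those `X` for which `X ⟶ *` is a fibration. -/
def fibrantObjects [HasTerminal C] : ObjectProperty C := fun X => M.fib (terminal.from X)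

end ModelStructure

/-- `F` is a Quillen bifunctor: for cofibrations `f : U ⟶ V` and `g : X ⟶ Y`, the pushout `P` of
`F(U, Y) ⟵ F(U, X) ⟶ F(V, X)` exists, the induced map `P ⟶ F(V, Y)` (which is
`Functor.PushoutObjObj.ι`) is a cofibration, and it is trivial if one of `f`, `g` is. -/
structure IsQuillenBifunctor {C D E : Type*} [Category* C] [Category* D] [Category* E]
    (MC : ModelStructure C) (MD : ModelStructure D) (ME : ModelStructure E)
    (F : C ⥤ D ⥤ E) : Prop where
  hasPushout : ∀ {U V : C} {X Y : D} (f : U ⟶ V) (g : X ⟶ Y), MC.cof f → MD.cof g →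
    HasPushout ((F.map f).app X) ((F.obj U).map g)
  cof_ι : ∀ {U V : C} {X Y : D} (f : U ⟶ V) (g : X ⟶ Y), MC.cof f → MD.cof g →
    ∀ sq : F.PushoutObjObj f g, ME.cof sq.ι
  trivCof_ι : ∀ {U V : C} {X Y : D} (f : U ⟶ V) (g : X ⟶ Y), MC.cof f → MD.cof g →
    (MC.weq f ∨ MD.weq g) → ∀ sq : F.PushoutObjObj f g, ME.trivCof sq.ι

/-- A monoidal model category: a model category with a closed symmetric monoidal structure whose
unit is cofibrant and whose tensor product is a Quillen bifunctor. -/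
structure IsMonoidalModelCategory {C : Type u} [Category.{v} C] [MonoidalCategory C]
    [SymmetricCategory C] [MonoidalClosed C] (M : ModelStructure C) : Prop where
  isModelCategory : M.IsModelCategory
  unit_cofibrant : haveI := isModelCategory.hasInitial; M.cofibrantObjects (𝟙_ C)
  tensor_quillen : IsQuillenBifunctor M M M (curriedTensor C)

end ModelStructures

section ExactModelCategories

variable {E : Type u} [Category.{v} E] [Preadditive E] [HasZeroObject E] [HasBinaryBiproducts E]

/-- An exact model category: a weakly idempotent complete exact category with a model structure
whose two weak factorization systems are exact. -/
structure IsExactModelCategory (S : ExactStructure E) (M : ModelStructure E) : Prop where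
  weaklyIdempotentComplete : IsWeaklyIdempotentComplete E
  exact_cof_trivFib : S.IsExactWFS M.cof M.trivFib
  exact_trivCof_fib : S.IsExactWFS M.trivCof M.fib

/-- An exact monoidal model category. -/
structure IsExactMonoidalModelCategory [MonoidalCategory E] [SymmetricCategory E]
    [MonoidalClosed E] (S : ExactStructure E) (M : ModelStructure E) : Prop where
  isExactModelCategory : IsExactModelCategory S M
  isMonoidalModelCategory : IsMonoidalModelCategory M

end ExactModelCategories

end ExactModel

namespace ExactModel

/-! Exactness of the factorization systems turns the Quillen condition into one about cokernels: for
cofibrations `f : U ⟶ V`, `g : X ⟶ Y` with cokernels `A`, `B`, it suffices that `f □ g` is an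
inflation with cokernel `A ⊗ B`; hypotheses on cofibrant and trivial objects do the rest. Tensoring
is a left adjoint, so it keeps cokernels, and it keeps `f` and `g` inflations. Hence the pushout `P`
sits in a conflation `U ⊗ Y ⟶ P ⟶ A ⊗ X` (`conflation_of_isPushout`), which `f □ g` maps to `U ⊗ Y ⟶
V ⊗ Y ⟶ A ⊗ Y`, with the identity on the left and `A ◁ g` on the right. By a snake-type argument
(`conflation_of_map`), `f □ g` is an inflation with the cokernel `A ⊗ B` of `A ◁ g`. -/

lemma map_comp_map_eq_zero {D : Type*} [Category* D] [Preadditive D] [HasZeroObject D]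
    (F : D ⥤ D) [F.IsLeftAdjoint] {X Y Z : D} {i : X ⟶ Y} {d : Y ⟶ Z}
    (w : i ≫ d = 0) : F.map i ≫ F.map d = 0 := by
  have := Functor.preservesZeroMorphisms_of_isLeftAdjoint F
  rw [← F.map_comp, w, F.map_zero]

/-! ### Diagram lemmas in exact categories -/

section ExactStructures

variable {E : Type u} [Category.{v} E] [Preadditive E] [HasZeroObject E]
    [HasBinaryBiproducts E] (S : ExactStructure E)

namespace ExactStructure

variable {S}

lemma conflation_of_isos {X Y Z X' Y' Z' : E} {i : X ⟶ Y} {d : Y ⟶ Z} {i' : X' ⟶ Y'} {d' : Y' ⟶ Z'}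
    {w : i ≫ d = 0} {w' : i' ≫ d' = 0} (h : S.conflation (ShortComplex.mk i d w)) (e₁ : X ≅ X')
    (e₂ : Y ≅ Y') (e₃ : Z ≅ Z') (comm : e₁.hom ≫ i' = i ≫ e₂.hom)
    (comm' : e₂.hom ≫ d' = d ≫ e₃.hom) : S.conflation (ShortComplex.mk i' d' w') := by
  refine S.conflation_of_iso ?_ h
  exact ShortComplex.isoMk e₁ e₂ e₃ comm comm'

/-- An inflation forms a conflation together with any of its cokernels. -/
lemma conflation_of_isColimit {X Y Z : E} {i : X ⟶ Y} (hi : S.inflations i) (d : Y ⟶ Z)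
    (w : i ≫ d = 0) (hd : IsColimit (CokernelCofork.ofπ d w)) :
    S.conflation (ShortComplex.mk i d w) := by
  obtain ⟨A, e, we, he⟩ := hi
  obtain ⟨hA⟩ := S.isCokernel he
  have comm := hA.comp_coconePointUniqueUpToIso_hom hd WalkingParallelPair.one
  refine conflation_of_isos he (Iso.refl _) (Iso.refl _) (hA.coconePointUniqueUpToIso hd)
    (by simp) ?_
  simpa using comm.symm

lemma mono_of_conflation {T : ShortComplex E} (h : S.conflation T) : Mono T.f :=
  mono_of_isLimit_fork (S.isKernel h).some

lemma epi_of_conflation {T : ShortComplex E} (h : S.conflation T) : Epi T.g :=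
  epi_of_isColimit_cofork (S.isCokernel h).some

lemma conflation_lift {X Y Z : E} {i : X ⟶ Y} {d : Y ⟶ Z} {w : i ≫ d = 0}
    (h : S.conflation (ShortComplex.mk i d w)) {A : E} (a : A ⟶ Y) (ha : a ≫ d = 0) :
    ∃ b : A ⟶ X, b ≫ i = a :=
  ⟨_, (KernelFork.IsLimit.lift' (S.isKernel h).some a ha).2⟩

lemma conflation_desc {X Y Z : E} {i : X ⟶ Y} {d : Y ⟶ Z} {w : i ≫ d = 0}
    (h : S.conflation (ShortComplex.mk i d w)) {A : E} (a : Y ⟶ A) (ha : i ≫ a = 0) :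
    ∃ b : Z ⟶ A, d ≫ b = a :=
  ⟨_, (CokernelCofork.IsColimit.desc' (S.isCokernel h).some a ha).2⟩

/-- A morphism which is a kernel of a deflation is an inflation with that deflation as cokernel. -/
lemma conflation_of_lift {K X Y : E} {k : K ⟶ X} {p : X ⟶ Y} [Mono k] (w : k ≫ p = 0)
    (hp : ∃ (A : E) (i : A ⟶ X) (w : i ≫ p = 0), S.conflation (ShortComplex.mk i p w))
    (lift : ∀ {A : E} (a : A ⟶ X), a ≫ p = 0 → ∃ b : A ⟶ K, b ≫ k = a) :
    S.conflation (ShortComplex.mk k p w) := by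
  obtain ⟨A, i, wi, hi⟩ := hp
  have : Mono i := mono_of_conflation hi
  obtain ⟨b, hb⟩ := lift i wi
  obtain ⟨c, hc⟩ := conflation_lift hi k w
  exact conflation_of_isos hi
    ⟨b, c, by simp [← cancel_mono i, hb, hc], by simp [← cancel_mono k, hb, hc]⟩
    (Iso.refl _) (Iso.refl _) (by simp [hb]) (by simp)

/-- Given a morphism of conflations which is the identity on the left and an inflation `k` on the
right, the morphism in the middle is an inflation with the same cokernel as `k`. -/
lemma conflation_of_map {A B B' X X' D : E} {a : A ⟶ B} {p : B ⟶ X} {a' : A ⟶ B'} {p' : B' ⟶ X'}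
    {k : X ⟶ X'} {e : X' ⟶ D} {w : a ≫ p = 0} {w' : a' ≫ p' = 0} {wk : k ≫ e = 0}
    (h : S.conflation (ShortComplex.mk a p w)) (h' : S.conflation (ShortComplex.mk a' p' w'))
    (hk : S.conflation (ShortComplex.mk k e wk)) (m : B ⟶ B') (ham : a ≫ m = a')
    (hmp : m ≫ p' = p ≫ k) (wm : m ≫ p' ≫ e = 0) :
    S.conflation (ShortComplex.mk m (p' ≫ e) wm) := by
  have : Mono k := mono_of_conflation hk
  have : Mono a' := mono_of_conflation h'
  have : Mono m := by
    refine Preadditive.mono_of_cancel_zero _ fun {T} t ht => ?_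
    obtain ⟨s, rfl⟩ := conflation_lift h t (by
      rw [← cancel_mono k, Category.assoc, ← hmp, reassoc_of% ht, zero_comp, zero_comp])
    rw [Category.assoc, ham] at ht
    rw [zero_of_comp_mono a' ht, zero_comp]
  -- As `p' ≫ e` is a composite of deflations, it remains to see that `m` is its kernel.
  refine conflation_of_lift wm (S.comp_deflation p' e ⟨_, _, _, h'⟩ ⟨_, _, _, hk⟩) ?_
  intro T t ht
  obtain ⟨s, hs⟩ := conflation_lift hk (t ≫ p') (by simpa using ht)
  -- The map `s` need not lift along `p` on `T` itself, but it does after passing to the deflation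
  -- `q : T' ⟶ T`.
  obtain ⟨T', r, q, hT', R, j, wj, hj⟩ := S.pullback_deflation p s ⟨_, _, _, h⟩
  have : Epi q := epi_of_conflation hj
  -- The lift `r` is off only by a map killed by `p'`, so it can be corrected by a map through `a`.
  obtain ⟨x, hx⟩ := conflation_lift h' (q ≫ t - r ≫ m) (by
    rw [Preadditive.sub_comp, Category.assoc, Category.assoc, hmp, ← hs, ← reassoc_of% hT'.w,
      sub_self])
  have hz : (r + x ≫ a) ≫ m = q ≫ t := by
    rw [Preadditive.add_comp, Category.assoc, ham, hx, add_sub_cancel]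
  -- The corrected lift descends along `q`: since `m` is mono, it kills the kernel `j` of `q`.
  obtain ⟨b, hb⟩ := conflation_desc hj (r + x ≫ a) (by
    rw [← cancel_mono m, Category.assoc, hz, reassoc_of% wj, zero_comp, zero_comp])
  exact ⟨b, by rw [← cancel_epi q, reassoc_of% hb, hz]⟩

/-- A pushout of an inflation is an inflation with the same cokernel. -/
lemma conflation_of_isPushout {X Y X' Y' Z : E} {i : X ⟶ Y} {a : X ⟶ X'} {b : Y ⟶ Y'}
    {i' : X' ⟶ Y'} {d : Y ⟶ Z} {w : i ≫ d = 0} (h : S.conflation (ShortComplex.mk i d w))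
    (sq : IsPushout i a b i') (d' : Y' ⟶ Z) (hb : b ≫ d' = d) (w' : i' ≫ d' = 0) :
    S.conflation (ShortComplex.mk i' d' w') := by
  have : Epi d := epi_of_conflation h
  have : Epi d' := epi_of_epi_fac hb
  refine conflation_of_isColimit ?_ d' w' ?_
  -- The axiom only provides some pushout with this property; it is transported to the given one by
  -- uniqueness.
  · obtain ⟨Y'', b', i'', sq', A, e, we, he⟩ := S.pushout_inflation i a ⟨_, _, _, h⟩
    let φ := sq'.isoIsPushout _ _ sq
    have hφ : i'' ≫ φ.hom = i' := IsPushout.inr_isoIsPushout_hom _ _ sq' sq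
    refine ⟨A, φ.inv ≫ e, by rw [← hφ]; simp [we],
      conflation_of_isos he (Iso.refl _) φ (Iso.refl _) (by simp [hφ]) (by simp)⟩
  · refine Nonempty.some ?_
    have key : ∀ {A : E} (t : Y' ⟶ A), i' ≫ t = 0 → ∃ s : Z ⟶ A, d' ≫ s = t := fun {A} t ht => by
      obtain ⟨s, hs⟩ := conflation_desc h (b ≫ t) (by
        rw [reassoc_of% sq.w, ht, comp_zero])
      refine ⟨s, sq.hom_ext ?_ ?_⟩
      · rw [reassoc_of% hb, hs]
      · rw [reassoc_of% w', ht, zero_comp]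
    exact ⟨CokernelCofork.IsColimit.ofπ' d' w' fun t ht => ⟨(key t ht).choose, (key t ht).choose_spec⟩⟩

lemma hasPushout_of_inflation {X Y X' : E} {i : X ⟶ Y} (hi : S.inflations i) (a : X ⟶ X') :
    HasPushout i a :=
  let ⟨_, _, _, sq, _⟩ := S.pushout_inflation i a hi
  sq.hasPushout

/-- Left adjoints preserve cokernels, so only the inflation property has to be assumed. -/
lemma conflation_map {F : E ⥤ E} [F.IsLeftAdjoint] {X Y Z : E} {i : X ⟶ Y} {d : Y ⟶ Z}
    {w : i ≫ d = 0} (h : S.conflation (ShortComplex.mk i d w)) (hi : S.inflations (F.map i))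
    (w' : F.map i ≫ F.map d = 0) :
    S.conflation (ShortComplex.mk (F.map i) (F.map d) w') := by
  have := Functor.preservesZeroMorphisms_of_isLeftAdjoint F
  exact conflation_of_isColimit hi _ w'
    (CokernelCofork.mapIsColimit _ (S.isCokernel h).some F)

end ExactStructure

end ExactStructures

/-! ### Pushout-products of inflations -/

section Tensor

variable {E : Type u} [Category.{v} E] [Preadditive E] [HasZeroObject E]
    [HasBinaryBiproducts E] [MonoidalCategory E] [SymmetricCategory E] [MonoidalClosed E]
    {S : ExactStructure E}

lemma inflations_whiskerRight {X Y : E} {f : X ⟶ Y} {U : E} (h : S.inflations (U ◁ f)) :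
    S.inflations (f ▷ U) := by
  obtain ⟨A, d, w, hd⟩ := h
  refine ⟨A, (β_ Y U).hom ≫ d, by simp [w],
    ExactStructure.conflation_of_isos hd (β_ U X) (β_ U Y) (Iso.refl _) (by simp) (by simp)⟩

/-- The pushout-product of two inflations which stay inflations after tensoring is an inflation,
and its cokernel is the tensor product of the cokernels. -/
lemma exists_conflation_pushoutProduct {U V A X Y B : E} {f : U ⟶ V} {p : V ⟶ A} {wf : f ≫ p = 0}
    {g : X ⟶ Y} {q : Y ⟶ B} {wg : g ≫ q = 0} (hf : S.conflation (ShortComplex.mk f p wf))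
    (hg : S.conflation (ShortComplex.mk g q wg)) (hfT : ∀ T : E, S.inflations (T ◁ f))
    (hgT : ∀ T : E, S.inflations (T ◁ g)) (sq : (curriedTensor E).PushoutObjObj f g) :
    ∃ (d : V ⊗ Y ⟶ A ⊗ B) (w : sq.ι ≫ d = 0), S.conflation (ShortComplex.mk sq.ι d w) := by
  have wX : f ▷ X ≫ p ▷ X = 0 := map_comp_map_eq_zero (tensorRight X) wf
  have wY : f ▷ Y ≫ p ▷ Y = 0 := map_comp_map_eq_zero (tensorRight Y) wf
  have wA : A ◁ g ≫ A ◁ q = 0 := map_comp_map_eq_zero (tensorLeft A) wg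
  have hX : S.conflation (ShortComplex.mk (f ▷ X) (p ▷ X) wX) :=
    ExactStructure.conflation_map (F := tensorRight X) hf (inflations_whiskerRight (hfT X)) wX
  have hY : S.conflation (ShortComplex.mk (f ▷ Y) (p ▷ Y) wY) :=
    ExactStructure.conflation_map (F := tensorRight Y) hf (inflations_whiskerRight (hfT Y)) wY
  have hA : S.conflation (ShortComplex.mk (A ◁ g) (A ◁ q) wA) :=
    ExactStructure.conflation_map (F := tensorLeft A) hg (hgT A) wA
  have po : IsPushout (f ▷ X) (U ◁ g) sq.inl sq.inr := sq.isPushout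
  have hl : sq.inl ≫ sq.ι = V ◁ g := sq.inl_ι
  have hr : sq.inr ≫ sq.ι = f ▷ Y := sq.inr_ι
  -- This is the cokernel of `sq.inr`, which is a pushout of `f ▷ X`.
  let r : sq.pt ⟶ A ⊗ X := po.desc (p ▷ X) 0 (by rw [wX, comp_zero])
  have hlr : sq.inl ≫ r = p ▷ X := po.inl_desc _ _ _
  have hrr : sq.inr ≫ r = 0 := po.inr_desc _ _ _
  have hP := ExactStructure.conflation_of_isPushout hX po r hlr hrr
  have comm : sq.ι ≫ p ▷ Y = r ≫ A ◁ g := by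
    refine po.hom_ext ?_ ?_
    · rw [reassoc_of% hl, reassoc_of% hlr, whisker_exchange]
    · rw [reassoc_of% hr, reassoc_of% hrr, wY, zero_comp]
  have w : sq.ι ≫ p ▷ Y ≫ A ◁ q = 0 := by rw [reassoc_of% comm, wA, comp_zero]
  exact ⟨_, w, ExactStructure.conflation_of_map hP hY hA sq.ι hr comm w⟩

end Tensor

/-! ### Model-categorical conclusions -/

section ExactModelCategories

variable {E : Type u} [Category.{v} E] [Preadditive E] [HasZeroObject E] [HasBinaryBiproducts E]
  {S : ExactStructure E} {M : ModelStructure E}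

/-- The model structure of an exact model category makes it a model category. -/
lemma IsExactModelCategory.isModelCategory (hM : IsExactModelCategory S M) :
    M.IsModelCategory where
  hasInitial := inferInstance
  hasTerminal := inferInstance
  hasPushout f g hf _ := by
    obtain ⟨Z, d, w, h, _⟩ := (hM.exact_trivCof_fib.left_iff f).1 hf
    exact ExactStructure.hasPushout_of_inflation ⟨Z, d, w, h⟩ g
  hasPullback f g hf hg := by
    obtain ⟨A, i, w, h, _⟩ := (hM.exact_cof_trivFib.right_iff f).1 hf
    obtain ⟨_, _, _, sq, _⟩ := S.pullback_deflation f g ⟨A, i, w, h⟩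
    exact sq.hasPullback

variable [MonoidalCategory E] [SymmetricCategory E] [MonoidalClosed E]

lemma IsExactModelCategory.isQuillenBifunctor_curriedTensor (hM : IsExactModelCategory S M)
    (tensor_cofibrant : ∀ X Y : E, M.cofibrantObjects X → M.cofibrantObjects Y →
      M.cofibrantObjects (X ⊗ Y))
    (tensor_trivial : ∀ X Y : E, M.cofibrantObjects X → M.cofibrantObjects Y →
      (M.trivialObjects X ∨ M.trivialObjects Y) →
        M.cofibrantObjects (X ⊗ Y) ∧ M.trivialObjects (X ⊗ Y))
    (tensor_inflation : ∀ (U : E) {X Y : E} (f : X ⟶ Y), M.cof f → S.inflations (U ◁ f)) :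
    IsQuillenBifunctor M M M (curriedTensor E) where
  hasPushout {U V X Y} f g hf hg :=
    ExactStructure.hasPushout_of_inflation (inflations_whiskerRight (tensor_inflation X f hf)) _
  cof_ι f g hf hg sq := by
    obtain ⟨A, p, wp, hp, hA⟩ := (hM.exact_cof_trivFib.left_iff f).1 hf
    obtain ⟨B, q, wq, hq, hB⟩ := (hM.exact_cof_trivFib.left_iff g).1 hg
    obtain ⟨d, w, h⟩ := exists_conflation_pushoutProduct hp hq
      (fun T => tensor_inflation T f hf) (fun T => tensor_inflation T g hg) sq
    exact (hM.exact_cof_trivFib.left_iff _).2 ⟨_, d, w, h, tensor_cofibrant A B hA hB⟩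
  trivCof_ι f g hf hg hfg sq := by
    -- Only one of `f`, `g` need be trivial, so each cokernel is taken from the factorization system
    -- that applies to its map, and triviality is recorded conditionally.
    obtain ⟨A, p, wp, hp, hA, hAf⟩ : ∃ (A : E) (p : _ ⟶ A) (w : f ≫ p = 0),
        S.conflation (ShortComplex.mk f p w) ∧ M.cofibrantObjects A ∧
          (M.weq f → M.trivialObjects A) := by
      by_cases hw : M.weq f
      · obtain ⟨A, p, w, h, h'⟩ := (hM.exact_trivCof_fib.left_iff f).1 ⟨hf, hw⟩
        exact ⟨A, p, w, h, h'.1, fun _ => h'.2⟩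
      · obtain ⟨A, p, w, h, h'⟩ := (hM.exact_cof_trivFib.left_iff f).1 hf
        exact ⟨A, p, w, h, h', fun h => (hw h).elim⟩
    obtain ⟨B, q, wq, hq, hB, hBg⟩ : ∃ (B : E) (q : _ ⟶ B) (w : g ≫ q = 0),
        S.conflation (ShortComplex.mk g q w) ∧ M.cofibrantObjects B ∧
          (M.weq g → M.trivialObjects B) := by
      by_cases hw : M.weq g
      · obtain ⟨A, p, w, h, h'⟩ := (hM.exact_trivCof_fib.left_iff g).1 ⟨hg, hw⟩
        exact ⟨A, p, w, h, h'.1, fun _ => h'.2⟩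
      · obtain ⟨A, p, w, h, h'⟩ := (hM.exact_cof_trivFib.left_iff g).1 hg
        exact ⟨A, p, w, h, h', fun h => (hw h).elim⟩
    obtain ⟨d, w, h⟩ := exists_conflation_pushoutProduct hp hq
      (fun T => tensor_inflation T f hf) (fun T => tensor_inflation T g hg) sq
    exact (hM.exact_trivCof_fib.left_iff _).2
      ⟨_, d, w, h, tensor_trivial A B hA hB (hfg.imp hAf hBg)⟩

end ExactModelCategories

end ExactModel

theorem mainTheorem11 {E : Type u} [Category.{v} E] [Preadditive E] [HasZeroObject E]
    [HasBinaryBiproducts E] [MonoidalCategory E] [SymmetricCategory E] [MonoidalClosed E]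
    (S : ExactModel.ExactStructure E) (M : ExactModel.ModelStructure E)
    (hM : ExactModel.IsExactModelCategory S M)
    (C W F : ObjectProperty E)
    (hC : C = M.cofibrantObjects) (hW : W = M.trivialObjects) (hF : F = M.fibrantObjects)
    (unit_cofibrant : C (𝟙_ E))
    (tensor_cofibrant : ∀ X Y : E, C X → C Y → C (X ⊗ Y))
    (tensor_trivial : ∀ X Y : E, C X → C Y → (W X ∨ W Y) → C (X ⊗ Y) ∧ W (X ⊗ Y))
    (tensor_inflation : ∀ (U : E) {X Y : E} (f : X ⟶ Y), M.cof f → S.inflations (U ◁ f)) :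
    ExactModel.IsExactMonoidalModelCategory S M := by
  subst hC hW
  exact ⟨hM, hM.isModelCategory, unit_cofibrant,
    hM.isQuillenBifunctor_curriedTensor tensor_cofibrant tensor_trivial tensor_inflation⟩
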